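/- Fix $\lambda_M,\lambda_{UA},P_M,P_{UA},\alpha_L,\alpha_N,\eta>0$ and $\mu\in\mathbb R$, and let $W_L(\theta)=\bigl(1+\eta\exp(-\mu(\tfrac{180}{\pi}\sin^{-1}(\cos\theta)-\eta))\bigr)^{-1}$. TBSs form a homogeneous Poisson process of intensity $\lambda_M$ on $\mathbb R^2$; independently, UAV-APs form a homogeneous Poisson process of intensity $\lambda_{UA}$ on the half-space $\mathbb R^2\times(0,\infty)$, each of them, independently, being in NLoS with probability $1-W_L(\theta)$, where $\theta$ is its polar angle seen from the typical user at the origin. Let $d_{MA}$ and $d_{UAN}$ be the distances from the user to the closest TBS and to the closest NLoS UAV-AP. Given a LoS UAV-AP at distance $d$, put $R_{UAL}=P_{UA}d^{-\alpha_L}$, $R_{UAN}=P_{UA}d_{UAN}^{-\alpha_N}$, $R_{MA}=P_M d_{MA}^{-\alpha_N}$ and $$A_{UAL}(d)=\mathbb P(R_{UAL}>R_{UAN}>R_{MA})+\mathbb P(R_{UAL}>R_{MA}>R_{UAN}).$$ Write the LoS UAV-AP distance as $d=h_L/\cos\theta$ with $\theta$ uniform on $[-\pi/2,\pi/2]$,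 so that the deconditioned LoS association probability is $$\bar A_{UAL}(h_L)=\int_{-\pi/2}^{\pi/2}A_{UAL}\!\left(\frac{h_L}{\cos\rho}\right)\frac{1}{\pi}\,d\rho .$$ Then $\bar A_{UAL}(h_L)$ is strictly decreasing in the LoS UAV-AP height $h_L\in(0,\infty)$. The same holds if $A_{UAL}(d)$ is replaced in this integral by the explicit expression $$\int_{C}^\infty\Bigl[e^{-\kappa s^3}-e^{-\kappa (P_{UA}/P_M)^{3/\alpha_N}x^3}\Bigr]e^{-\pi\lambda_M C^2}f_{MA}(x)\,dx+\int_{s}^\infty\Bigl[e^{-\pi\lambda_M C^2}-e^{-\pi\lambda_M (P_M/P_{UA})^{2/\alpha_N}x^2}\Bigr]e^{-\kappa s^3}f_{UAN}(x)\,dx,$$ where $s=d^{\alpha_L/\alpha_N}$, $C=(P_M/P_{UA})^{1/\alpha_N}s$, $\kappa=\tfrac23\pi\lambda_{UA}W_N'$, $W_N'=\int_0^{\pi/2}(1-W_L(\theta))\sin\theta\,d\theta$, $f_{MA}(x)=2\pi\lambda_M x e^{-\pi\lambda_M x^2}$ and $f_{UAN}(x)=2\pi\lambda_{UA}W_N'x^2e^{-\kappa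 x^3}$. -/

import Mathlib

open MeasureTheory ProbabilityTheory Set

noncomputable section

namespace UAVNet

/-- The number of points of the random point set `Φ` in `B`, as an extended natural number. -/
def pointCount {Ω E : Type*} (Φ : Ω → Set E) (B : Set E) (ω : Ω) : ℕ∞ :=
  (Φ ω ∩ B).encard

/-- `Φ` is a (simple) Poisson point process on `E` with intensity measure `Λ`:
a random, almost surely locally finite set of points whose counts are measurable, Poisson
distributed with mean `Λ B`, and independent over disjoint sets. -/
structure IsPoissonProcess {Ω E : Type*} [MeasurableSpace Ω] [PseudoMetricSpace E]
    [MeasurableSpace E] (μ : Measure Ω) (Φ : Ω → Set E) (Λ : Measure E) : Prop where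
  measurable_count : ∀ B : Set E, MeasurableSet B → Measurable (pointCount Φ B)
  locally_finite : ∀ᵐ ω ∂μ, ∀ B : Set E, Bornology.IsBounded B → (Φ ω ∩ B).Finite
  poisson_count : ∀ B : Set E, MeasurableSet B → Λ B < ⊤ → ∀ k : ℕ,
    μ {ω | pointCount Φ B ω = (k : ℕ∞)} =
      ENNReal.ofReal (Real.exp (-(Λ B).toReal) * (Λ B).toReal ^ k / (k.factorial : ℝ))
  indep_count : ∀ (n : ℕ) (B : Fin n → Set E), (∀ i, MeasurableSet (B i)) →
    Pairwise (fun i j => Disjoint (B i) (B j)) →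
    iIndepFun (fun i => pointCount Φ (B i)) μ

/-- The sigma-algebra on `Ω` generated by all counts of the random point set `Φ`. -/
abbrev countSigma {Ω E : Type*} [MeasurableSpace E] (Φ : Ω → Set E) : MeasurableSpace Ω :=
  ⨆ (B : Set E) (_ : MeasurableSet B), MeasurableSpace.comap (pointCount Φ B) inferInstance

/-- The distance from the typical user, at the origin, to the closest point of `S`. -/
def nearestDist {E : Type*} [Norm E] (S : Set E) : ℝ :=
  sInf ((fun x => ‖x‖) '' S)

/-- The plane, which contains the typical user and the TBSs. -/
abbrev Plane : Type := EuclideanSpace ℝ (Fin 2)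

/-- Three-dimensional space; the coordinate `x 2` is the height. -/
abbrev Space : Type := EuclideanSpace ℝ (Fin 3)

/-- The parameters of the access network. -/
structure Params where
  /-- intensity of the TBSs -/
  lamM : ℝ
  /-- intensity of the UAV-APs -/
  lamUA : ℝ
  /-- transmit power of a TBS -/
  PM : ℝ
  /-- transmit power of a UAV-AP -/
  PUA : ℝ
  /-- path loss exponent of LoS links -/
  aL : ℝ
  /-- path loss exponent of NLoS and TBS links -/
  aN : ℝ
  /-- first environment parameter -/
  eta : ℝ
  /-- second environment parameter -/
  mu : ℝ
  lamM_pos : 0 < lamM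
  lamUA_pos : 0 < lamUA
  PM_pos : 0 < PM
  PUA_pos : 0 < PUA
  aL_pos : 0 < aL
  aN_pos : 0 < aN
  eta_pos : 0 < eta

namespace Params

/-- The probability of a LoS link to a UAV-AP at polar angle `θ`. -/
def WL (p : Params) (θ : ℝ) : ℝ :=
  1 / (1 + p.eta * Real.exp
    (-p.mu * (180 / Real.pi * Real.arcsin (Real.cos θ) - p.eta)))

/-- `W'_N`. -/
def WN' (p : Params) : ℝ :=
  ∫ θ in (0 : ℝ)..(Real.pi / 2), (1 - p.WL θ) * Real.sin θ

end Params

/-- The polar angle of a point of space, seen from the origin. -/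
def polarAngle (x : Space) : ℝ := Real.arccos (x 2 / ‖x‖)

/-- The intensity measure of the UAV-APs with their visibility marks: `lamUA` times Lebesgue
measure on the upper half space, times the uniform law of the mark on `[0, 1]`. -/
def markedIntensity (p : Params) : Measure (Space × ℝ) :=
  (ENNReal.ofReal p.lamUA • (volume : Measure Space).restrict {x | 0 < x 2}).prod
    ((volume : Measure ℝ).restrict (Icc 0 1))

/-- The NLoS UAV-APs. A UAV-AP at `x` with mark `u` is in LoS if `u` is at most the LoS
probability at the polar angle of `x`, and in NLoS otherwise. -/
def nlosPoints (p : Params) (S : Set (Space × ℝ)) : Set Space :=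
  {x | ∃ u : ℝ, (x, u) ∈ S ∧ p.WL (polarAngle x) < u}

/-- The random access network: the TBSs `tbs` form a homogeneous planar Poisson process, the
UAV-APs with independent uniform visibility marks `uav` form a marked homogeneous Poisson process
in the upper half space, and the two are independent. -/
structure IsAccessNetwork {Ω : Type*} [MeasurableSpace Ω] (μ : Measure Ω) (p : Params)
    (tbs : Ω → Set Plane) (uav : Ω → Set (Space × ℝ)) : Prop where
  tbs_poisson : IsPoissonProcess μ tbs (ENNReal.ofReal p.lamM • volume)
  uav_poisson : IsPoissonProcess μ uav (markedIntensity p)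
  indep : Indep (countSigma tbs) (countSigma uav) μ

section Association

variable {Ω : Type*} [MeasurableSpace Ω] (μ : Measure Ω) (p : Params)
  (tbs : Ω → Set Plane) (uav : Ω → Set (Space × ℝ))

/-- Average received power from a LoS UAV-AP at distance `d`. The common path loss coefficient
of all tiers cancels in every comparison of powers and is omitted. -/
def RUAL (d : ℝ) : ℝ := p.PUA * d ^ (-p.aL)

/-- Average received power from the closest NLoS UAV-AP. -/
def RUAN (ω : Ω) : ℝ := p.PUA * nearestDist (nlosPoints p (uav ω)) ^ (-p.aN)

/-- Average received power from the closest TBS. -/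
def RMA (ω : Ω) : ℝ := p.PM * nearestDist (tbs ω) ^ (-p.aN)

/-- The probability that the user associates with the LoS UAV-AP, given its distance `d`. -/
def losAssoc (d : ℝ) : ℝ :=
  μ.real {ω | RUAL p d > RUAN p uav ω ∧ RUAN p uav ω > RMA p tbs ω} +
  μ.real {ω | RUAL p d > RMA p tbs ω ∧ RMA p tbs ω > RUAN p uav ω}

/-- The average of `A (h / cos θ)` over `θ` uniform on `[-π/2, π/2]`. -/
def decondition (A : ℝ → ℝ) (h : ℝ) : ℝ :=
  ∫ ρ in (-(Real.pi / 2))..(Real.pi / 2), A (h / Real.cos ρ) * (1 / Real.pi)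

end Association

namespace Params

/-- The density of the distance to the closest TBS. -/
def fMA (p : Params) (x : ℝ) : ℝ :=
  2 * Real.pi * p.lamM * x * Real.exp (-(Real.pi * p.lamM * x ^ 2))

/-- The density of the distance to the closest NLoS UAV-AP. -/
def fUAN (p : Params) (x : ℝ) : ℝ :=
  2 * Real.pi * p.lamUA * x ^ 2 * p.WN' *
    Real.exp (-(2 / 3 * Real.pi * p.lamUA * p.WN' * x ^ 3))

/-- `C_{L1}`. -/
def CL1 (p : Params) (d : ℝ) : ℝ := (p.PM / p.PUA) ^ (1 / p.aN) * d ^ (p.aL / p.aN)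

/-- The explicit expression for the part of the LoS association probability in which the NLoS
UAV-AP is the second strongest. -/
def formula1 (p : Params) (d : ℝ) : ℝ :=
  ∫ x in Ioi (p.CL1 d),
    (Real.exp (-(2 / 3 * Real.pi * p.lamUA * p.WN' * (d ^ (p.aL / p.aN)) ^ 3)) -
      Real.exp (-(2 / 3 * Real.pi * p.lamUA * p.WN' *
        ((p.PUA / p.PM) ^ (1 / p.aN) * x) ^ 3))) *
    Real.exp (-(Real.pi * p.lamM * (p.CL1 d) ^ 2)) * p.fMA x

/-- The explicit expression for the part of the LoS association probability in which the TBS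
is the second strongest. -/
def formula2 (p : Params) (d : ℝ) : ℝ :=
  ∫ x in Ioi (d ^ (p.aL / p.aN)),
    (Real.exp (-(Real.pi * p.lamM * (p.CL1 d) ^ 2)) -
      Real.exp (-(Real.pi * p.lamM * ((p.PM / p.PUA) ^ (1 / p.aN) * x) ^ 2))) *
    Real.exp (-(2 / 3 * Real.pi * p.lamUA * p.WN' * (d ^ (p.aL / p.aN)) ^ 3)) * p.fUAN x

/-- The explicit expression for the LoS association probability given the distance `d`. -/
def losAssocFormula (p : Params) (d : ℝ) : ℝ := p.formula1 d + p.formula2 d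

end Params

end UAVNet

end

namespace UAVNet

/-! For `ρ` inside the interval, `cos ρ > 0` and `h / cos ρ` increases with `h`. Strict decrease of
a bounded `A` therefore passes to its average (`strictAntiOn_decondition`), and only monotonicity in
the distance `d` remains.

For the probability itself, no law of the nearest distances is computed. Raising `d` lowers the LoS
power and shrinks both association events. Strictness comes from an event of positive probability on
which the TBS beats the NLoS UAV-APs and its power falls between the two LoS powers
(`IsAccessNetwork.exists_separating_event`).

The explicit expression is treated separately, without identifying it with the probability. Each
half integrates a positive function over a tail; as `d` grows, the tail shrinks and the integrand
drops pointwise (`strictAntiOn_tail_integral`). -/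

/-! ### Monotonicity of tail integrals and of the angular average. -/

lemma setIntegral_Ioi_lt_of_lt {f g : ℝ → ℝ} {a b : ℝ} (hab : a ≤ b)
    (hf : IntegrableOn f (Ioi a)) (hg : IntegrableOn g (Ioi b))
    (hf0 : ∀ x ∈ Ioi a, 0 ≤ f x) (hlt : ∀ x ∈ Ioi b, g x < f x) :
    ∫ x in Ioi b, g x < ∫ x in Ioi a, f x := by
  have hfb : IntegrableOn f (Ioi b) := hf.mono_set (Ioi_subset_Ioi hab)
  have h1 : ∫ x in Ioi b, f x ≤ ∫ x in Ioi a, f x :=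
    setIntegral_mono_set hf ((ae_restrict_iff' measurableSet_Ioi).2 (ae_of_all _ hf0))
      (Ioi_subset_Ioi hab).eventuallyLE
  refine lt_of_lt_of_le ?_ h1
  have h2 : 0 < ∫ x in Ioi b, (f x - g x) := by
    rw [setIntegral_pos_iff_support_of_nonneg_ae
      ((ae_restrict_iff' measurableSet_Ioi).2
        (ae_of_all _ fun x hx => (sub_pos.2 (hlt x hx)).le)) (hfb.sub hg)]
    have : Ioi b ⊆ Function.support (fun x => f x - g x) ∩ Ioi b :=
      fun x hx => ⟨(sub_pos.2 (hlt x hx)).ne', hx⟩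
    exact lt_of_lt_of_le (by simp) (measure_mono this)
  rw [integral_sub hfb hg] at h2
  linarith

/-- Common shape of `formula1` and `formula2`, which differ by exchanging the two tiers. By `huv`
the bracket is positive on the whole tail, so moving `l d` to the right only discards positive mass.
The factor before `f` is at most 1, hence `f` dominates. -/
lemma strictAntiOn_tail_integral {l u w v f : ℝ → ℝ}
    (hl : MonotoneOn l (Ici 0)) (hl0 : ∀ d ∈ Ici (0 : ℝ), 0 ≤ l d)
    (hu : StrictAntiOn u (Ici 0)) (hu1 : ∀ d ∈ Ici (0 : ℝ), u d ≤ 1)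
    (hw : AntitoneOn w (Ici 0)) (hw0 : ∀ d, 0 < w d) (hw1 : ∀ d ∈ Ici (0 : ℝ), w d ≤ 1)
    (hv : Continuous v) (hv0 : ∀ x, 0 ≤ v x)
    (huv : ∀ d ∈ Ici (0 : ℝ), ∀ x ∈ Ioi (l d), v x < u d)
    (hf : Continuous f) (hfi : IntegrableOn f (Ioi 0)) (hf0 : ∀ x ∈ Ioi (0 : ℝ), 0 < f x) :
    StrictAntiOn (fun d => ∫ x in Ioi (l d), (u d - v x) * w d * f x) (Ici 0) := by
  have hpos : ∀ d ∈ Ici (0 : ℝ), ∀ x ∈ Ioi (l d), 0 < (u d - v x) * w d * f x :=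
    fun d hd x hx => mul_pos (mul_pos (sub_pos.2 (huv d hd x hx)) (hw0 d))
      (hf0 x ((hl0 d hd).trans_lt hx))
  have hint : ∀ d ∈ Ici (0 : ℝ),
      IntegrableOn (fun x => (u d - v x) * w d * f x) (Ioi (l d)) := by
    intro d hd
    refine Integrable.mono' (hfi.mono_set (Ioi_subset_Ioi (hl0 d hd)))
      (by fun_prop) ((ae_restrict_iff' measurableSet_Ioi).2 (ae_of_all _ fun x hx => ?_))
    rw [Real.norm_of_nonneg (hpos d hd x hx).le]
    have h1 : (u d - v x) * w d ≤ 1 :=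
      mul_le_one₀ (by linarith [hu1 d hd, hv0 x]) (hw0 d).le (hw1 d hd)
    exact mul_le_of_le_one_left (hf0 x ((hl0 d hd).trans_lt hx)).le h1
  intro a ha b hb hab
  refine setIntegral_Ioi_lt_of_lt (hl ha hb hab.le) (hint a ha) (hint b hb)
    (fun x hx => (hpos a ha x hx).le) fun x hx => ?_
  have hx0 := hf0 x ((hl0 b hb).trans_lt hx)
  refine mul_lt_mul_of_pos_right ?_ hx0
  have h1 : u b - v x < u a - v x := sub_lt_sub_right (hu ha hb hab) _
  exact mul_lt_mul h1 (hw ha hb hab.le) (hw0 b)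
    ((sub_pos.2 (huv b hb x hx)).le.trans h1.le)

lemma strictAntiOn_decondition {A : ℝ → ℝ} {M : ℝ} (hA : StrictAntiOn A (Ioi 0))
    (hM : ∀ d ∈ Ioi (0 : ℝ), |A d| ≤ M) : StrictAntiOn (decondition A) (Ioi 0) := by
  have hpi : -(Real.pi / 2) ≤ Real.pi / 2 := by linarith [Real.pi_pos]
  have hint : ∀ h ∈ Ioi (0 : ℝ), IntegrableOn (fun ρ => A (h / Real.cos ρ) * (1 / Real.pi))
      (Ioo (-(Real.pi / 2)) (Real.pi / 2)) := by
    intro h hh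
    -- Monotonicity gives measurability, but `A` is controlled only on the positive axis; it is
    -- extended by zero.
    have hB : Measurable (fun x : ℝ => if 0 < x then A x else 0) := by
      have hr : Measurable (fun x : Ioi (0 : ℝ) => A x) :=
        Antitone.measurable fun x y hxy => hA.antitoneOn x.2 y.2 hxy
      refine measurable_of_restrict_of_restrict_compl (s := Ioi (0 : ℝ)) measurableSet_Ioi ?_ ?_
      · convert hr using 2 with x
        exact if_pos x.2
      · convert (measurable_const : Measurable (fun _ : ↥((Ioi (0 : ℝ))ᶜ) => (0 : ℝ))) using 2 with x
        exact if_neg x.2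
    have hm : Measurable fun ρ : ℝ => (if 0 < h / Real.cos ρ then A (h / Real.cos ρ) else 0) *
        (1 / Real.pi) :=
      (hB.comp (measurable_const.div Real.measurable_cos)).mul_const _
    have hpos : ∀ ρ ∈ Ioo (-(Real.pi / 2)) (Real.pi / 2), 0 < h / Real.cos ρ :=
      fun ρ hρ => div_pos hh (Real.cos_pos_of_mem_Ioo hρ)
    refine IntegrableOn.congr_fun (f := fun ρ : ℝ =>
      (if 0 < h / Real.cos ρ then A (h / Real.cos ρ) else 0) * (1 / Real.pi)) ?_
      (fun ρ hρ => by simp only [if_pos (hpos ρ hρ)]) measurableSet_Ioo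
    refine Integrable.mono' (g := fun _ => M * (1 / Real.pi)) (integrable_const _)
      hm.aestronglyMeasurable ((ae_restrict_iff' measurableSet_Ioo).2 (ae_of_all _ fun ρ hρ => ?_))
    simp only [if_pos (hpos ρ hρ)]
    rw [norm_mul, Real.norm_of_nonneg (by positivity : (0 : ℝ) ≤ 1 / Real.pi)]
    exact mul_le_mul_of_nonneg_right (hM _ (hpos ρ hρ)) (by positivity)
  intro a ha b hb hab
  -- The endpoints are dropped: there the cosine vanishes and the quotient is the default 0, outside
  -- the domain of `hA`.
  simp only [decondition, intervalIntegral.integral_of_le hpi, integral_Ioc_eq_integral_Ioo]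
  rw [← sub_pos, ← integral_sub (hint a ha) (hint b hb)]
  have hlt : ∀ ρ ∈ Ioo (-(Real.pi / 2)) (Real.pi / 2),
      0 < A (a / Real.cos ρ) * (1 / Real.pi) - A (b / Real.cos ρ) * (1 / Real.pi) := by
    intro ρ hρ
    have hc := Real.cos_pos_of_mem_Ioo hρ
    rw [sub_pos]
    exact mul_lt_mul_of_pos_right
      (hA (div_pos ha hc) (div_pos hb hc) (div_lt_div_of_pos_right hab hc))
      (by positivity)
  rw [setIntegral_pos_iff_support_of_nonneg_ae
    ((ae_restrict_iff' measurableSet_Ioo).2 (ae_of_all _ fun ρ hρ => (hlt ρ hρ).le))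
    ((hint a ha).sub (hint b hb))]
  refine lt_of_lt_of_le ?_ (measure_mono (s := Ioo (-(Real.pi / 2)) (Real.pi / 2))
    fun ρ hρ => ⟨(hlt ρ hρ).ne', hρ⟩)
  rw [Real.volume_Ioo, ENNReal.ofReal_pos]
  linarith [Real.pi_pos]

/-! ### The explicit expression and the distance thresholds. -/

namespace Params

variable (p : Params)

lemma WL_lt_one (θ : ℝ) : p.WL θ < 1 := by
  have := mul_pos p.eta_pos (Real.exp_pos
    (-p.mu * (180 / Real.pi * Real.arcsin (Real.cos θ) - p.eta)))
  rw [WL, div_lt_one (by linarith)]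
  linarith

lemma continuous_WL : Continuous p.WL := by
  unfold WL
  refine continuous_const.div (by fun_prop) fun θ => ?_
  have := mul_pos p.eta_pos (Real.exp_pos
    (-p.mu * (180 / Real.pi * Real.arcsin (Real.cos θ) - p.eta)))
  linarith

lemma WN'_pos : 0 < p.WN' := by
  refine intervalIntegral.intervalIntegral_pos_of_pos_on ?_ (fun θ hθ => ?_)
    (by linarith [Real.pi_pos])
  · have := p.continuous_WL
    exact Continuous.intervalIntegrable (by fun_prop) _ _
  · exact mul_pos (sub_pos.2 (p.WL_lt_one θ))
      (Real.sin_pos_of_pos_of_lt_pi hθ.1 (by linarith [hθ.2, Real.pi_pos]))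

lemma continuous_fMA : Continuous p.fMA := by
  unfold fMA; fun_prop

lemma continuous_fUAN : Continuous p.fUAN := by
  unfold fUAN; fun_prop

lemma fMA_pos {x : ℝ} (hx : 0 < x) : 0 < p.fMA x := by
  have := p.lamM_pos
  unfold fMA; positivity

lemma fUAN_pos {x : ℝ} (hx : 0 < x) : 0 < p.fUAN x := by
  have := p.lamUA_pos
  have := p.WN'_pos
  unfold fUAN; positivity

lemma integrableOn_fMA : IntegrableOn p.fMA (Ioi 0) := by
  have := p.lamM_pos
  have h := ((integrable_mul_exp_neg_mul_sq (b := Real.pi * p.lamM) (by positivity)).const_mul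
    (2 * Real.pi * p.lamM)).integrableOn (s := Ioi 0)
  refine h.congr_fun (fun x _ => ?_) measurableSet_Ioi
  simp only [fMA]
  ring_nf

lemma integrableOn_fUAN : IntegrableOn p.fUAN (Ioi 0) := by
  have := p.lamUA_pos
  have := p.WN'_pos
  have h := (integrableOn_rpow_mul_exp_neg_mul_rpow (p := (3 : ℕ)) (s := (2 : ℕ))
    (b := 2 / 3 * Real.pi * p.lamUA * p.WN') (by norm_num) (by norm_num)
    (by positivity)).const_mul (2 * Real.pi * p.lamUA * p.WN')
  refine IntegrableOn.congr_fun h (fun x _ => ?_) measurableSet_Ioi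
  simp only [fUAN, Real.rpow_natCast]
  ring_nf

lemma powerRatio_pos : 0 < (p.PM / p.PUA) ^ (1 / p.aN) :=
  Real.rpow_pos_of_pos (div_pos p.PM_pos p.PUA_pos) _

lemma powerRatio_inv : (p.PUA / p.PM) ^ (1 / p.aN) = ((p.PM / p.PUA) ^ (1 / p.aN))⁻¹ := by
  rw [← Real.inv_rpow (div_pos p.PM_pos p.PUA_pos).le, inv_div]

lemma strictMonoOn_rpow_ratio : StrictMonoOn (fun d : ℝ => d ^ (p.aL / p.aN)) (Ici 0) :=
  Real.strictMonoOn_rpow_Ici_of_exponent_pos (div_pos p.aL_pos p.aN_pos)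

lemma strictMonoOn_CL1 : StrictMonoOn p.CL1 (Ici 0) :=
  fun _ ha _ hb hab => mul_lt_mul_of_pos_left (p.strictMonoOn_rpow_ratio ha hb hab)
    p.powerRatio_pos

lemma CL1_nonneg {d : ℝ} (hd : 0 ≤ d) : 0 ≤ p.CL1 d :=
  mul_nonneg p.powerRatio_pos.le (Real.rpow_nonneg hd _)

lemma exp_neg_mul_pow_lt {c x y : ℝ} (hc : 0 < c) (hx : 0 ≤ x) (hxy : x < y) {n : ℕ}
    (hn : n ≠ 0) : Real.exp (-(c * y ^ n)) < Real.exp (-(c * x ^ n)) :=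
  Real.exp_lt_exp.2 (neg_lt_neg (mul_lt_mul_of_pos_left (pow_lt_pow_left₀ hxy hx hn) hc))

lemma exp_neg_mul_pow_le_one {c x : ℝ} (hc : 0 < c) (hx : 0 ≤ x) (n : ℕ) :
    Real.exp (-(c * x ^ n)) ≤ 1 :=
  Real.exp_le_one_iff.2 (neg_nonpos.2 (by positivity))

lemma lt_inv_powerRatio_mul {d x : ℝ} (hx : p.CL1 d < x) :
    d ^ (p.aL / p.aN) < (p.PUA / p.PM) ^ (1 / p.aN) * x := by
  rw [powerRatio_inv, inv_mul_eq_div, lt_div_iff₀ p.powerRatio_pos, mul_comm]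
  exact hx

lemma strictAntiOn_formula1 : StrictAntiOn p.formula1 (Ici 0) := by
  have := p.lamUA_pos
  have := p.lamM_pos
  have := p.WN'_pos
  have hk : 0 < 2 / 3 * Real.pi * p.lamUA * p.WN' := by positivity
  have ha : 0 < Real.pi * p.lamM := by positivity
  have hs : ∀ d ∈ Ici (0 : ℝ), 0 ≤ d ^ (p.aL / p.aN) := fun d hd => Real.rpow_nonneg hd _
  exact strictAntiOn_tail_integral
    (u := fun d => Real.exp (-(2 / 3 * Real.pi * p.lamUA * p.WN' * (d ^ (p.aL / p.aN)) ^ 3)))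
    (w := fun d => Real.exp (-(Real.pi * p.lamM * (p.CL1 d) ^ 2)))
    p.strictMonoOn_CL1.monotoneOn (fun d hd => p.CL1_nonneg hd)
    (fun a h b h' hab => exp_neg_mul_pow_lt hk (hs a h)
      (p.strictMonoOn_rpow_ratio h h' hab) three_ne_zero)
    (fun d hd => exp_neg_mul_pow_le_one hk (hs d hd) 3)
    (StrictAntiOn.antitoneOn fun a h b h' hab => exp_neg_mul_pow_lt ha (p.CL1_nonneg h)
      (p.strictMonoOn_CL1 h h' hab) two_ne_zero)
    (fun d => Real.exp_pos _) (fun d hd => exp_neg_mul_pow_le_one ha (p.CL1_nonneg hd) 2)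
    (by fun_prop) (fun x => (Real.exp_pos _).le)
    (fun d hd x hx => exp_neg_mul_pow_lt hk (hs d hd) (p.lt_inv_powerRatio_mul hx) three_ne_zero)
    p.continuous_fMA p.integrableOn_fMA (fun x hx => p.fMA_pos hx)

lemma strictAntiOn_formula2 : StrictAntiOn p.formula2 (Ici 0) := by
  have := p.lamUA_pos
  have := p.lamM_pos
  have := p.WN'_pos
  have hk : 0 < 2 / 3 * Real.pi * p.lamUA * p.WN' := by positivity
  have ha : 0 < Real.pi * p.lamM := by positivity
  have hs : ∀ d ∈ Ici (0 : ℝ), 0 ≤ d ^ (p.aL / p.aN) := fun d hd => Real.rpow_nonneg hd _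
  exact strictAntiOn_tail_integral
    (l := fun d => d ^ (p.aL / p.aN))
    (w := fun d => Real.exp (-(2 / 3 * Real.pi * p.lamUA * p.WN' * (d ^ (p.aL / p.aN)) ^ 3)))
    (u := fun d => Real.exp (-(Real.pi * p.lamM * (p.CL1 d) ^ 2)))
    p.strictMonoOn_rpow_ratio.monotoneOn hs
    (fun a h b h' hab => exp_neg_mul_pow_lt ha (p.CL1_nonneg h)
      (p.strictMonoOn_CL1 h h' hab) two_ne_zero)
    (fun d hd => exp_neg_mul_pow_le_one ha (p.CL1_nonneg hd) 2)
    (StrictAntiOn.antitoneOn fun a h b h' hab => exp_neg_mul_pow_lt hk (hs a h)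
      (p.strictMonoOn_rpow_ratio h h' hab) three_ne_zero)
    (fun d => Real.exp_pos _) (fun d hd => exp_neg_mul_pow_le_one hk (hs d hd) 3)
    (by fun_prop) (fun x => (Real.exp_pos _).le)
    (fun d hd x hx => exp_neg_mul_pow_lt ha (p.CL1_nonneg hd)
      (mul_lt_mul_of_pos_left hx p.powerRatio_pos) two_ne_zero)
    p.continuous_fUAN p.integrableOn_fUAN (fun x hx => p.fUAN_pos hx)

lemma strictAntiOn_losAssocFormula : StrictAntiOn p.losAssocFormula (Ici 0) :=
  fun _ ha _ hb hab =>
    add_lt_add (p.strictAntiOn_formula1 ha hb hab) (p.strictAntiOn_formula2 ha hb hab)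

lemma losAssocFormula_nonneg {d : ℝ} (hd : 0 ≤ d) : 0 ≤ p.losAssocFormula d := by
  have := p.lamUA_pos
  have := p.lamM_pos
  have := p.WN'_pos
  have hs : 0 ≤ d ^ (p.aL / p.aN) := Real.rpow_nonneg hd _
  refine add_nonneg (setIntegral_nonneg measurableSet_Ioi fun x hx => ?_)
    (setIntegral_nonneg measurableSet_Ioi fun x hx => ?_)
  · exact mul_nonneg (mul_nonneg (sub_nonneg.2 (exp_neg_mul_pow_lt (by positivity) hs
      (p.lt_inv_powerRatio_mul hx) three_ne_zero).le) (Real.exp_pos _).le)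
      (p.fMA_pos ((p.CL1_nonneg hd).trans_lt hx)).le
  · exact mul_nonneg (mul_nonneg (sub_nonneg.2 (exp_neg_mul_pow_lt (by positivity)
      (p.CL1_nonneg hd) (mul_lt_mul_of_pos_left hx p.powerRatio_pos) two_ne_zero).le)
      (Real.exp_pos _).le) (p.fUAN_pos (hs.trans_lt hx)).le

/-- Here and in `PM_mul_CL1_rpow`, the limits of integration are recognised as the distances at
which the other tiers match the LoS power. -/
lemma PUA_mul_rpow_threshold {d : ℝ} (hd : 0 < d) :
    p.PUA * (d ^ (p.aL / p.aN)) ^ (-p.aN) = RUAL p d := by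
  rw [RUAL, ← Real.rpow_mul hd.le]
  have := p.aN_pos
  congr 2
  field_simp

lemma PM_mul_CL1_rpow {d : ℝ} (hd : 0 < d) : p.PM * p.CL1 d ^ (-p.aN) = RUAL p d := by
  have hM := p.PM_pos
  have hU := p.PUA_pos
  have hN := p.aN_pos
  rw [← p.PUA_mul_rpow_threshold hd, CL1,
    Real.mul_rpow p.powerRatio_pos.le (Real.rpow_nonneg hd.le _), ← mul_assoc,
    ← Real.rpow_mul (div_pos hM hU).le]
  have : 1 / p.aN * -p.aN = -1 := by field_simp
  rw [this, Real.rpow_neg_one]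
  congr 1
  field_simp

end Params

/-! ### Locating the nearest point of a Poisson process with positive probability. -/

/-- The witness `y` also excludes the empty set, whose `nearestDist` is the default 0. -/
lemma nearestDist_mem_Icc {E : Type*} [Norm E] {S : Set E} {r R : ℝ}
    (hr : ∀ x ∈ S, r ≤ ‖x‖) {y : E} (hy : y ∈ S) (hyR : ‖y‖ ≤ R) :
    nearestDist S ∈ Icc r R := by
  constructor
  · refine le_csInf ⟨_, mem_image_of_mem _ hy⟩ ?_
    rintro _ ⟨x, hx, rfl⟩
    exact hr x hx
  · refine (csInf_le ⟨r, ?_⟩ (mem_image_of_mem _ hy)).trans hyR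
    rintro _ ⟨x, hx, rfl⟩
    exact hr x hx

/-- The event that `Φ` has no point in `A` and exactly one point in `B`. -/
def voidHitEvent {Ω E : Type*} (Φ : Ω → Set E) (A B : Set E) : Set Ω :=
  {ω | pointCount Φ A ω = 0 ∧ pointCount Φ B ω = 1}

/-- Measurability is needed for `countSigma`, because independence of the two tiers is stated
between these sigma-algebras. -/
lemma measurableSet_countSigma_voidHitEvent {Ω E : Type*} [MeasurableSpace E]
    (Φ : Ω → Set E) {A B : Set E} (hA : MeasurableSet A) (hB : MeasurableSet B) :
    MeasurableSet[countSigma Φ] (voidHitEvent Φ A B) := by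
  have h : ∀ C : Set E, MeasurableSet C → ∀ k : ℕ∞,
      MeasurableSet[countSigma Φ] (pointCount Φ C ⁻¹' {k}) := fun C hC k =>
    (le_iSup₂ (f := fun (B : Set E) (_ : MeasurableSet B) =>
      MeasurableSpace.comap (pointCount Φ B) inferInstance) C hC) _
      ⟨{k}, measurableSet_singleton k, rfl⟩
  exact MeasurableSet.inter (h A hA 0) (h B hB 1)

lemma countSigma_le {Ω E : Type*} [MeasurableSpace Ω] [PseudoMetricSpace E] [MeasurableSpace E]
    {μ : Measure Ω} {Φ : Ω → Set E} {Λ : Measure E} (h : IsPoissonProcess μ Φ Λ) :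
    countSigma Φ ≤ ‹MeasurableSpace Ω› :=
  iSup₂_le fun B hB => (h.measurable_count B hB).comap_le

/-- Counts in disjoint sets are independent, so the probability is `exp (-Λ A)` times `Λ B * exp (-Λ
B)`. -/
lemma IsPoissonProcess.voidHitEvent_pos {Ω E : Type*} [MeasurableSpace Ω] [PseudoMetricSpace E]
    [MeasurableSpace E] {μ : Measure Ω} {Φ : Ω → Set E} {Λ : Measure E}
    (h : IsPoissonProcess μ Φ Λ) {A B : Set E} (hA : MeasurableSet A) (hB : MeasurableSet B)
    (hAB : Disjoint A B) (hAf : Λ A < ⊤) (hBf : Λ B < ⊤) (hB0 : 0 < Λ B) :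
    0 < μ (voidHitEvent Φ A B) := by
  have hind := (h.indep_count 2 ![A, B]
    (by intro i; fin_cases i <;> assumption)
    (by
      intro i j hij
      fin_cases i <;> fin_cases j <;> simp_all [disjoint_comm])).indepFun
      (show (0 : Fin 2) ≠ 1 by decide)
  have := hind.measure_inter_preimage_eq_mul {0} {1} (measurableSet_singleton _)
    (measurableSet_singleton _)
  have heq : voidHitEvent Φ A B = (pointCount Φ (![A, B] 0)) ⁻¹' {0} ∩
      (pointCount Φ (![A, B] 1)) ⁻¹' {1} := rfl
  rw [heq, this]
  have h0 := h.poisson_count A hA hAf 0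
  have h1 := h.poisson_count B hB hBf 1
  have e0 : (pointCount Φ (![A, B] 0)) ⁻¹' {0} = {ω | pointCount Φ A ω = ((0 : ℕ) : ℕ∞)} := by
    ext; simp
  have e1 : (pointCount Φ (![A, B] 1)) ⁻¹' {1} = {ω | pointCount Φ B ω = ((1 : ℕ) : ℕ∞)} := by
    ext; simp
  have hBr : 0 < (Λ B).toReal := ENNReal.toReal_pos hB0.ne' hBf.ne
  rw [e0, e1, h0, h1]
  refine ENNReal.mul_pos (ENNReal.ofReal_pos.2 ?_).ne' (ENNReal.ofReal_pos.2 ?_).ne'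
  · simp [Real.exp_pos]
  · simp only [pow_one, Nat.factorial_one, Nat.cast_one, div_one]
    positivity

lemma exists_mem_of_pointCount_eq_one {Ω E : Type*} {Φ : Ω → Set E} {B : Set E} {ω : Ω}
    (h : pointCount Φ B ω = 1) : ∃ x ∈ Φ ω, x ∈ B := by
  obtain ⟨x, hx⟩ := Set.encard_eq_one.1 h
  have : x ∈ Φ ω ∩ B := hx ▸ mem_singleton x
  exact ⟨x, this.1, this.2⟩

lemma notMem_of_pointCount_eq_zero {Ω E : Type*} {Φ : Ω → Set E} {A : Set E} {ω : Ω}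
    (h : pointCount Φ A ω = 0) {x : E} (hx : x ∈ Φ ω) : x ∉ A :=
  fun hxA => (Set.encard_eq_zero.1 h).subset ⟨hx, hxA⟩

/-! ### Intensity of shells and annuli. -/

/-- The points of the marked space seen in NLoS whose distance to the origin lies in `I`. -/
def nlosShell (p : Params) (I : Set ℝ) : Set (Space × ℝ) :=
  {z | ‖z.1‖ ∈ I ∧ p.WL (polarAngle z.1) < z.2}

lemma measurable_polarAngle : Measurable polarAngle := by
  unfold polarAngle
  exact Real.measurable_arccos.comp (by fun_prop)

lemma measurableSet_nlosShell (p : Params) {I : Set ℝ} (hI : MeasurableSet I) :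
    MeasurableSet (nlosShell p I) := by
  refine MeasurableSet.inter ((measurable_norm.comp measurable_fst) hI) ?_
  exact measurableSet_lt
    (p.continuous_WL.measurable.comp (measurable_polarAngle.comp measurable_fst)) measurable_snd

lemma markedIntensity_nlosShell_lt_top (p : Params) {I : Set ℝ} {R : ℝ} (hI : I ⊆ Iic R) :
    markedIntensity p (nlosShell p I) < ⊤ := by
  have hsub : nlosShell p I ⊆ Metric.closedBall (0 : Space) R ×ˢ (univ : Set ℝ) :=
    fun z hz => ⟨mem_closedBall_zero_iff.2 (hI hz.1), mem_univ _⟩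
  refine (measure_mono hsub).trans_lt ?_
  rw [markedIntensity, Measure.prod_prod]
  refine ENNReal.mul_lt_top ?_ (by simp)
  rw [Measure.smul_apply, smul_eq_mul]
  exact ENNReal.mul_lt_top ENNReal.ofReal_lt_top
    ((Measure.restrict_apply_le _ _).trans_lt measure_closedBall_lt_top)

lemma markedIntensity_nlosShell_Ioc_pos (p : Params) {r R : ℝ} (hr : 0 < r) (hrR : r < R) :
    0 < markedIntensity p (nlosShell p (Ioc r R)) := by
  -- By compactness the LoS probability stays below some `c < 1`, so a mark above `c` forces NLoS at
  -- every angle. The shell then contains an open set times an interval of marks.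
  obtain ⟨c, hc1, hc⟩ : ∃ c < 1, ∀ θ ∈ Icc 0 Real.pi, p.WL θ ≤ c := by
    obtain ⟨θ₀, -, h⟩ := isCompact_Icc.exists_isMaxOn (nonempty_Icc.2 Real.pi_pos.le)
      p.continuous_WL.continuousOn
    exact ⟨p.WL θ₀, p.WL_lt_one θ₀, fun θ hθ => h hθ⟩
  let U : Set Space := {x | 0 < x 2 ∧ r < ‖x‖ ∧ ‖x‖ < R}
  have hU : IsOpen U := by
    have h2 : Continuous fun x : Space => x 2 := by fun_prop
    refine IsOpen.inter (isOpen_lt continuous_const h2)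
      (IsOpen.inter (isOpen_lt continuous_const continuous_norm)
        (isOpen_lt continuous_norm continuous_const))
  have hUne : U.Nonempty := by
    have : ‖EuclideanSpace.single (2 : Fin 3) ((r + R) / 2)‖ = (r + R) / 2 := by
      rw [PiLp.norm_single, Real.norm_of_nonneg (by linarith)]
    refine ⟨EuclideanSpace.single (2 : Fin 3) ((r + R) / 2), ?_, ?_, ?_⟩
    · simp; linarith
    · rw [this]; linarith
    · rw [this]; linarith
  have hsub : U ×ˢ Ioc (max c 0) 1 ⊆ nlosShell p (Ioc r R) := fun z hz =>
    ⟨⟨hz.1.2.1, hz.1.2.2.le⟩, (hc _ ⟨Real.arccos_nonneg _, Real.arccos_le_pi _⟩).trans_lt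
      ((le_max_left _ _).trans_lt hz.2.1)⟩
  refine lt_of_lt_of_le ?_ (measure_mono hsub)
  rw [markedIntensity, Measure.prod_prod, Measure.smul_apply, smul_eq_mul,
    Measure.restrict_apply hU.measurableSet, Measure.restrict_apply measurableSet_Ioc]
  refine ENNReal.mul_pos (ENNReal.mul_pos (ENNReal.ofReal_pos.2 p.lamUA_pos).ne' ?_).ne' ?_
  · rw [inter_eq_left.2 (fun x hx => hx.1)]
    exact (hU.measure_pos _ hUne).ne'
  · have : Ioc (max c 0) 1 ⊆ Icc 0 1 :=
      fun x hx => ⟨(le_max_right c 0).trans hx.1.le, hx.2⟩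
    rw [inter_eq_left.2 this, Real.volume_Ioc]
    exact (ENNReal.ofReal_pos.2 (sub_pos.2 (max_lt hc1 one_pos))).ne'

lemma volume_plane_annulus_pos {r R : ℝ} (hr : 0 < r) (hrR : r < R) :
    0 < (volume : Measure Plane) {x | ‖x‖ ∈ Ioc r R} := by
  have hU : IsOpen {x : Plane | ‖x‖ ∈ Ioo r R} := isOpen_Ioo.preimage continuous_norm
  refine (hU.measure_pos volume ⟨EuclideanSpace.single 0 ((r + R) / 2), ?_⟩).trans_le
    (measure_mono fun x hx => Ioo_subset_Ioc_self hx)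
  change ‖EuclideanSpace.single (0 : Fin 2) ((r + R) / 2)‖ ∈ Ioo r R
  rw [PiLp.norm_single, Real.norm_of_nonneg (by linarith)]
  constructor <;> linarith

lemma nearestDist_tbs_mem_Icc {Ω : Type*} {tbs : Ω → Set Plane} {r R : ℝ} {ω : Ω}
    (h : ω ∈ voidHitEvent tbs {x | ‖x‖ ∈ Iic r} {x | ‖x‖ ∈ Ioc r R}) :
    nearestDist (tbs ω) ∈ Icc r R := by
  obtain ⟨y, hy, hyR⟩ := exists_mem_of_pointCount_eq_one h.2
  exact nearestDist_mem_Icc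
    (fun x hx => (not_le.1 (notMem_of_pointCount_eq_zero h.1 hx)).le) hy hyR.2

lemma nearestDist_nlos_mem_Icc {Ω : Type*} {p : Params} {uav : Ω → Set (Space × ℝ)}
    {r R : ℝ} {ω : Ω}
    (h : ω ∈ voidHitEvent uav (nlosShell p (Iic r)) (nlosShell p (Ioc r R))) :
    nearestDist (nlosPoints p (uav ω)) ∈ Icc r R := by
  obtain ⟨y, hy, hyR⟩ := exists_mem_of_pointCount_eq_one h.2
  refine nearestDist_mem_Icc ?_ (y := y.1) ⟨y.2, hy, hyR.2⟩ hyR.1.2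
  rintro x ⟨u, hxu, hu⟩
  by_contra hlt
  exact notMem_of_pointCount_eq_zero h.1 hxu ⟨(not_le.1 hlt).le, hu⟩

lemma RUAL_strictAntiOn (p : Params) : StrictAntiOn (RUAL p) (Ioi 0) :=
  fun _ ha _ _ hab => mul_lt_mul_of_pos_left
    (Real.rpow_lt_rpow_of_neg ha hab (neg_neg_of_pos p.aL_pos)) p.PUA_pos

/-! ### Strict decrease of the association probability. -/

section Network

variable {Ω : Type*} [MeasurableSpace Ω] {μ : Measure Ω} {p : Params}
  {tbs : Ω → Set Plane} {uav : Ω → Set (Space × ℝ)}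

/-- With positive probability the TBS is the strongest of the other tiers, at a distance between
the thresholds of two LoS distances. -/
lemma IsAccessNetwork.exists_separating_event (hnet : IsAccessNetwork μ p tbs uav) {a b : ℝ}
    (ha : 0 < a) (hab : a < b) :
    ∃ F : Set Ω, MeasurableSet F ∧ 0 < μ F ∧ ∀ ω ∈ F, RMA p tbs ω < RUAL p a ∧
      RUAL p b ≤ RMA p tbs ω ∧ RUAN p uav ω < RMA p tbs ω := by
  have hb : 0 < b := ha.trans hab
  have hC := p.strictMonoOn_CL1 ha.le hb.le hab
  have hC0 := p.CL1_nonneg ha.le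
  have hN : -p.aN < 0 := neg_neg_of_pos p.aN_pos
  -- The nearest TBS will lie in `[r, CL1 b]`. The gap between `CL1 a` and `r` makes the comparison
  -- with the LoS power at `a` strict.
  obtain ⟨r, hr1, hr2⟩ := exists_between hC
  have hr0 : 0 < r := hC0.trans_lt hr1
  have hCa : 0 < p.CL1 a := mul_pos p.powerRatio_pos (Real.rpow_pos_of_pos ha _)
  have hs : 0 < b ^ (p.aL / p.aN) := Real.rpow_pos_of_pos hb _
  set s := b ^ (p.aL / p.aN) with hs_def
  set A : Set Plane := {x | ‖x‖ ∈ Iic r}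
  set B : Set Plane := {x | ‖x‖ ∈ Ioc r (p.CL1 b)}
  have hA : MeasurableSet A := measurable_norm measurableSet_Iic
  have hB : MeasurableSet B := measurable_norm measurableSet_Ioc
  -- Beyond the threshold `s`, an NLoS UAV-AP is weaker than the LoS one at `b`, hence than the TBS.
  -- The offsets 1 and 2 are arbitrary.
  have hA' := measurableSet_nlosShell p (measurableSet_Iic (a := s + 1))
  have hB' := measurableSet_nlosShell p (measurableSet_Ioc (a := s + 1) (b := s + 2))
  have hfin : ∀ {S : Set Plane} {R : ℝ}, (∀ x ∈ S, ‖x‖ ≤ R) →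
      (ENNReal.ofReal p.lamM • (volume : Measure Plane)) S < ⊤ := by
    intro S R hS
    rw [Measure.smul_apply, smul_eq_mul]
    exact ENNReal.mul_lt_top ENNReal.ofReal_lt_top ((measure_mono fun x hx =>
      mem_closedBall_zero_iff.2 (hS x hx)).trans_lt (measure_closedBall_lt_top (r := R)))
  have hpos : 0 < μ (voidHitEvent tbs A B) := by
    refine hnet.tbs_poisson.voidHitEvent_pos hA hB
      (disjoint_left.2 fun x hx hx' => not_le.2 hx'.1 hx) (hfin fun x hx => hx)
      (hfin fun x hx => hx.2) ?_
    rw [Measure.smul_apply, smul_eq_mul]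
    exact ENNReal.mul_pos (ENNReal.ofReal_pos.2 p.lamM_pos).ne'
      (volume_plane_annulus_pos hr0 hr2).ne'
  have hpos' : 0 < μ (voidHitEvent uav (nlosShell p (Iic (s + 1)))
      (nlosShell p (Ioc (s + 1) (s + 2)))) :=
    hnet.uav_poisson.voidHitEvent_pos hA' hB'
      (disjoint_left.2 fun x hx hx' => not_le.2 hx'.1.1 hx.1)
      (markedIntensity_nlosShell_lt_top p subset_rfl)
      (markedIntensity_nlosShell_lt_top p fun x hx => hx.2)
      (markedIntensity_nlosShell_Ioc_pos p (by linarith) (by linarith))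
  have hm := measurableSet_countSigma_voidHitEvent tbs hA hB
  have hm' := measurableSet_countSigma_voidHitEvent uav hA' hB'
  refine ⟨_, (countSigma_le hnet.tbs_poisson _ hm).inter (countSigma_le hnet.uav_poisson _ hm'),
    ?_, ?_⟩
  · rw [(Indep_iff _ _ μ).1 hnet.indep _ _ hm hm']
    exact ENNReal.mul_pos hpos.ne' hpos'.ne'
  · rintro ω ⟨h1, h2⟩
    have hD := nearestDist_tbs_mem_Icc h1
    have hD' := nearestDist_nlos_mem_Icc h2
    have hge : RUAL p b ≤ RMA p tbs ω := by
      rw [← p.PM_mul_CL1_rpow hb, RMA]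
      exact mul_le_mul_of_nonneg_left
        (Real.rpow_le_rpow_of_nonpos (hr0.trans_le hD.1) hD.2 hN.le) p.PM_pos.le
    refine ⟨?_, hge, lt_of_lt_of_le ?_ hge⟩
    · rw [← p.PM_mul_CL1_rpow ha, RMA]
      exact mul_lt_mul_of_pos_left
        (Real.rpow_lt_rpow_of_neg hCa (hr1.trans_le hD.1) hN) p.PM_pos
    · rw [← p.PUA_mul_rpow_threshold hb, RUAN]
      exact mul_lt_mul_of_pos_left
        (Real.rpow_lt_rpow_of_neg hs (by linarith [hD'.1]) hN) p.PUA_pos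

lemma IsAccessNetwork.strictAntiOn_losAssoc [IsProbabilityMeasure μ]
    (hnet : IsAccessNetwork μ p tbs uav) : StrictAntiOn (losAssoc μ p tbs uav) (Ioi 0) := by
  intro a ha b hb hab
  obtain ⟨F, hFm, hF0, hF⟩ := hnet.exists_separating_event ha hab
  have hR := RUAL_strictAntiOn p ha hb hab
  refine add_lt_add_of_le_of_lt
    (measureReal_mono fun ω hω => ⟨lt_trans hω.1 hR, hω.2⟩) ?_
  have hdisj : Disjoint {ω | RUAL p b > RMA p tbs ω ∧ RMA p tbs ω > RUAN p uav ω} F :=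
    disjoint_left.2 fun ω hω hωF => not_lt.2 (hF ω hωF).2.1 hω.1
  have hF0' : 0 < μ.real F := ENNReal.toReal_pos hF0.ne' (measure_ne_top μ F)
  -- `F` lies in the event for `a` and misses the one for `b`. Additivity needs only `F` measurable;
  -- the association events need not be.
  calc _ < μ.real {ω | RUAL p b > RMA p tbs ω ∧ RMA p tbs ω > RUAN p uav ω} + μ.real F :=
        lt_add_of_pos_right _ hF0'
    _ = μ.real ({ω | RUAL p b > RMA p tbs ω ∧ RMA p tbs ω > RUAN p uav ω} ∪ F) :=
        (measureReal_union hdisj hFm).symm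
    _ ≤ _ := measureReal_mono (union_subset
        (r := {ω | RUAL p a > RMA p tbs ω ∧ RMA p tbs ω > RUAN p uav ω})
        (fun ω hω => ⟨lt_trans hω.1 hR, hω.2⟩) fun ω hω => ⟨(hF ω hω).1, (hF ω hω).2.2⟩)

lemma abs_losAssoc_le [IsProbabilityMeasure μ] (d : ℝ) : |losAssoc μ p tbs uav d| ≤ 2 := by
  rw [losAssoc, abs_of_nonneg (by positivity)]
  calc _ ≤ (1 : ℝ) + 1 := add_le_add measureReal_le_one measureReal_le_one
    _ = 2 := by norm_num

end Network

end UAVNet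

theorem corollary1 {Ω : Type*} [MeasurableSpace Ω] (μ : Measure Ω) [IsProbabilityMeasure μ]
    (p : UAVNet.Params) (tbs : Ω → Set UAVNet.Plane) (uav : Ω → Set (UAVNet.Space × ℝ))
    (hnet : UAVNet.IsAccessNetwork μ p tbs uav) :
    StrictAntiOn (UAVNet.decondition (UAVNet.losAssoc μ p tbs uav)) (Ioi 0) ∧
    StrictAntiOn (UAVNet.decondition p.losAssocFormula) (Ioi 0) := by
  refine ⟨UAVNet.strictAntiOn_decondition hnet.strictAntiOn_losAssoc
    fun d _ => UAVNet.abs_losAssoc_le d, ?_⟩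
  -- The formula is strictly decreasing on the closed half-line, so its value at 0 bounds it.
  refine UAVNet.strictAntiOn_decondition (M := p.losAssocFormula 0)
    (p.strictAntiOn_losAssocFormula.mono Ioi_subset_Ici_self) fun d hd => ?_
  rw [abs_of_nonneg (p.losAssocFormula_nonneg (le_of_lt hd))]
  exact (p.strictAntiOn_losAssocFormula self_mem_Ici (mem_Ici.2 (le_of_lt hd)) hd).le
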